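/- Let $\mathcal{C}_0$ be a Barr exact category (a regular category with finite limits in which every internal equivalence relation is a kernel pair). Let $\mathsf{Arr}^0(\mathcal{C}_0)=\mathcal{C}_0$ and let $\mathsf{Arr}^{n+1}(\mathcal{C}_0)$ be the category of arrows of $\mathsf{Arr}^{n}(\mathcal{C}_0)$. Let $\mathcal{E}_1$ be the class of regular epimorphisms of $\mathcal{C}_0$. For $n\geq 1$, let $\mathcal{E}_{n+1}$ be the class of those morphisms $\alpha\colon f_A\to f_B$ of $\mathsf{Arr}^{n}(\mathcal{C}_0)$, viewed as commutative squares in $\mathsf{Arr}^{n-1}(\mathcal{C}_0)$ with top side $\alpha_\top\colon A_\top\to B_\top$, bottom side $\alpha_\perp\colon A_\perp\to B_\perp$ and vertical sides $f_A\colon A_\top\to A_\perp$ and $f_B\colon B_\top\to B_\perp$, for which $f_A$, $f_B$, $\alpha_\top$, $\alpha_\perp$, both projections of the pullback $A_\perp\times_{B_\perp}B_\top$ and the comparison map $A_\top\to A_\perp\times_{B_\perp}B_\top$ all belong to $\mathcal{E}_n$. The elements of $\mathcal{E}_n$ are called $n$-fold extensions. For $n\geq 1$, let $\mathcal{C}_n$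 be the full subcategory of $\mathsf{Arr}^n(\mathcal{C}_0)$ whose objects are the $n$-fold extensions; then $\mathcal{E}_{n+1}$ may be viewed as a class of morphisms of $\mathcal{C}_n$. For every $n\geq 0$ and every $(n+1)$-fold extension $e\colon E\to B$ in $\mathcal{C}_n$ the following hold. 1. $e$ is of (global) effective descent in $\mathcal{C}_n$: the pullback along $e$ of every morphism of $\mathcal{C}_n$ with codomain $B$ exists in $\mathcal{C}_n$, and the pullback functor $e^*\colon \mathcal{C}_n/B\to\mathcal{C}_n/E$ (right adjoint to composition with $e$) is monadic. 2. $e$ is of effective $\mathcal{E}_{n+1}$-descent in $\mathcal{C}_n$: writing $\mathsf{Ext}(Z)$ for the full subcategory of $\mathcal{C}_n/Z$ whose objects are the morphisms in $\mathcal{E}_{n+1}$ with codomain $Z$, composition with $e$ and pullback along $e$ restrict to functors $\mathsf{Ext}(E)\to\mathsf{Ext}(B)$ and $\mathsf{Ext}(B)\to\mathsf{Ext}(E)$, and the latter is monadic. -/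

import Mathlib

universe v u

open CategoryTheory Limits

namespace HigherExt

/-- A Barr exact category: a regular category (finite limits, coequalisers of kernel pairs,
pullback-stable regular epimorphisms) in which every internal equivalence relation is effective,
that is, is the kernel pair of its coequaliser. -/
class BarrExact (C : Type u) [Category.{v} C] : Prop extends Regular C where
  effective {R X : C} (p₁ p₂ : R ⟶ X) [IsEquivalenceRelation p₁ p₂] :
    IsEffectiveEquivalenceRelation p₁ p₂

section DoubleExtension

variable {Y : Type u} [Category.{v} Y]

/-- A commutative square in `Y`, viewed as a morphism `α : f ⟶ g` of the arrow category, with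
top component `α.left` and bottom component `α.right`, is an `E`-double extension when the pullback
of `α.right` and `g.hom` exists, and the four sides of the square, the two projections `π₁`, `π₂`
of the pullback and the comparison map `p` to the pullback all belong to `E`. -/
def doubleExtension (E : MorphismProperty Y) : MorphismProperty (Arrow Y) :=
  fun f g α =>
    E f.hom ∧ E g.hom ∧ E α.left ∧ E α.right ∧
      ∃ (P : Y) (π₁ : P ⟶ f.right) (π₂ : P ⟶ g.left) (p : f.left ⟶ P),
        IsPullback π₁ π₂ α.right g.hom ∧ p ≫ π₁ = f.hom ∧ p ≫ π₂ = α.left ∧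
          E π₁ ∧ E π₂ ∧ E p

end DoubleExtension

section Tower

variable (C : Type (max u v)) [Category.{v} C]

/-- The tower of higher arrows `Arrⁿ(C)`: `Arr⁰(C) = C` and `Arrⁿ⁺¹(C) = Arr(Arrⁿ(C))`. -/
def HArr : ℕ → Cat.{v, max u v}
  | 0 => Cat.of C
  | n + 1 => Cat.of (Arrow (HArr n))

/-- `extClass C n` is the class `ℰₙ₊₁` of `(n+1)`-fold extensions, a class of morphisms of
`Arrⁿ(C)`: `ℰ₁` consists of the regular epimorphisms of `C`, and `ℰₙ₊₂` of the `ℰₙ₊₁`-double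
extensions. -/
def extClass : (n : ℕ) → MorphismProperty (HArr.{v, u} C n)
  | 0 => MorphismProperty.regularEpi C
  | n + 1 => doubleExtension (extClass n)

/-- The objects of `Arrⁿ(C)` which are `n`-fold extensions (all objects of `C` for `n = 0`). -/
def isExt : (n : ℕ) → ObjectProperty (HArr.{v, u} C n)
  | 0 => fun _ => True
  | n + 1 => fun f : Arrow (HArr.{v, u} C n) => extClass.{v, u} C n f.hom

/-- The `n`-th level `Cₙ = Extⁿ(C)` of the tower of extensions: the full subcategory of `Arrⁿ(C)`
on the `n`-fold extensions. -/
abbrev ExtCat (n : ℕ) : Type (max u v) := (isExt.{v, u} C n).FullSubcategory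

/-- The class `ℰₙ₊₁` of `(n+1)`-fold extensions, as a class of morphisms of `Cₙ`. -/
def ext (n : ℕ) : MorphismProperty (ExtCat.{v, u} C n) :=
  (extClass.{v, u} C n).inverseImage (isExt.{v, u} C n).ι

end Tower

section Descent

variable {Y : Type u} [Category.{v} Y]

/-- `e : X ⟶ B` is of (global) effective descent: pullbacks of arbitrary morphisms along `e` exist,
and the pullback functor `e^* : Y/B ⥤ Y/X`, right adjoint to composition with `e`, is monadic. -/
def IsEffectiveDescent {X B : Y} (e : X ⟶ B) : Prop :=
  ∃ _ : HasPullbacksAlong e, Nonempty (MonadicRightAdjoint (Over.pullback e))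

/-- `e : X ⟶ B` is of effective `E`-descent: writing `E.Over ⊤ B` for the full subcategory of the
slice over `B` on the morphisms in `E`, composition with `e` restricts to
`E.Over ⊤ X ⥤ E.Over ⊤ B`, pullback along `e` exists and restricts to
`e^*| : E.Over ⊤ B ⥤ E.Over ⊤ X`, and `e^*|` is monadic. -/
def IsEffectiveRelDescent (E : MorphismProperty Y) {X B : Y} (e : X ⟶ B) : Prop :=
  (∀ {A : Y} (k : A ⟶ X), E k → E (k ≫ e)) ∧
    ∃ (_ : E.HasPullbacksAlong e) (_ : E.IsStableUnderBaseChangeAlong e),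
      Nonempty (MonadicRightAdjoint (MorphismProperty.Over.pullback E ⊤ e))

end Descent

end HigherExt

/-! Let `E` be the class of `(n+1)`-fold extensions and let `e` be one of them. Every base change of
`e` is a regular epimorphism, which makes the comparison functor of `e^*` fully faithful; it is
essentially surjective as soon as every descent datum along `e` is effective. Such a datum, an
action of the kernel pair of `e` on some `γ : D ⟶ X`, generates an equivalence relation on `D`. In a
Barr exact category this relation is the kernel pair of its quotient `D ⟶ A`, and by the Barr–Kock
argument `γ` is then the pullback along `e` of the induced morphism `A ⟶ B`. One level up, the two
components of a descent datum between arrows are descended separately, and the arrow induced between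
the quotients is again an extension because `E` is right cancellable: if `f` and `f ≫ g` are in `E`,
then so is `g`. Right cancellation also shows that the morphism `A ⟶ B` is in `E` when `γ` is, which
is what effective `E`-descent requires beyond global descent. These closure properties pass from `E`
to the `E`-double extensions, so the theorem follows by induction on `n`. -/

namespace HigherExt

section Monadicity

variable {A : Type*} [Category* A] {D : Type*} [Category* D] {L : D ⥤ A} {R : A ⥤ D}

theorem map_comp_counit_eq_counit_comp_iff (adj : L ⊣ R) {Z W : A} {M : D}
    (f : R.obj Z ⟶ M) (g : M ⟶ R.obj W) (k : Z ⟶ W) :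
    L.map f ≫ L.map g ≫ adj.counit.app W = adj.counit.app Z ≫ k ↔ f ≫ g = R.map k := by
  have hk : adj.counit.app Z ≫ k = (adj.homEquiv _ _).symm (R.map k) := by
    rw [adj.homEquiv_counit, adj.counit_naturality]
  have hfg : L.map f ≫ L.map g ≫ adj.counit.app W = (adj.homEquiv _ _).symm (f ≫ g) := by
    rw [adj.homEquiv_counit, L.map_comp_assoc]
  rw [hk, hfg, EmbeddingLike.apply_eq_iff_eq]

theorem full_comparison_of_counit_exists_desc (adj : L ⊣ R)
    (hdesc : ∀ {Z W : A} (k : L.obj (R.obj Z) ⟶ W),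
      L.map (R.map (adj.counit.app Z)) ≫ k = adj.counit.app (L.obj (R.obj Z)) ≫ k →
        ∃ l : Z ⟶ W, adj.counit.app Z ≫ l = k) :
    (Monad.comparison adj).Full where
  map_surjective := by
    rintro Z W ⟨f, hf⟩
    change R.obj Z ⟶ R.obj W at f
    change R.map (L.map f) ≫ R.map (adj.counit.app W) = R.map (adj.counit.app Z) ≫ f at hf
    obtain ⟨l, hl⟩ := hdesc (L.map f ≫ adj.counit.app W) <|
      (map_comp_counit_eq_counit_comp_iff adj _ f _).2 (by rw [R.map_comp, hf])
    have hlf : 𝟙 (R.obj Z) ≫ f = R.map l :=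
      (map_comp_counit_eq_counit_comp_iff adj _ f l).1 (by rw [L.map_id, Category.id_comp, hl])
    exact ⟨l, Monad.Algebra.Hom.ext (hlf.symm.trans (Category.id_comp f))⟩

theorem essSurj_comparison_of_exists_iso (adj : L ⊣ R)
    (halg : ∀ {M : D} (a : R.obj (L.obj M) ⟶ M), adj.unit.app M ≫ a = 𝟙 M →
      R.map (adj.counit.app (L.obj M)) ≫ a = R.map (L.map a) ≫ a →
        ∃ (Z : A) (i : M ≅ R.obj Z), L.map a ≫ L.map i.hom ≫ adj.counit.app Z =
          adj.counit.app (L.obj M) ≫ L.map i.hom ≫ adj.counit.app Z) :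
    (Monad.comparison adj).EssSurj where
  mem_essImage M := by
    obtain ⟨Z, i, hi⟩ := halg M.a M.unit M.assoc
    have hstr := (map_comp_counit_eq_counit_comp_iff adj M.a i.hom _).1 hi
    exact ⟨Z, ⟨(Monad.Algebra.isoMk i ((R.map_comp _ _).symm.trans hstr.symm)).symm⟩⟩

theorem nonempty_monadicRightAdjoint (adj : L ⊣ R) [R.Faithful]
    (hdesc : ∀ {Z W : A} (k : L.obj (R.obj Z) ⟶ W),
      L.map (R.map (adj.counit.app Z)) ≫ k = adj.counit.app (L.obj (R.obj Z)) ≫ k →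
        ∃ l : Z ⟶ W, adj.counit.app Z ≫ l = k)
    (halg : ∀ {M : D} (a : R.obj (L.obj M) ⟶ M), adj.unit.app M ≫ a = 𝟙 M →
      R.map (adj.counit.app (L.obj M)) ≫ a = R.map (L.map a) ≫ a →
        ∃ (Z : A) (i : M ≅ R.obj Z), L.map a ≫ L.map i.hom ≫ adj.counit.app Z =
          adj.counit.app (L.obj M) ≫ L.map i.hom ≫ adj.counit.app Z) :
    Nonempty (MonadicRightAdjoint R) := by
  have := full_comparison_of_counit_exists_desc adj hdesc
  have := essSurj_comparison_of_exists_iso adj halg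
  exact ⟨⟨L, adj, { }⟩⟩

end Monadicity

section DescentData

variable {Y : Type*} [Category* Y]

/-- A descent datum on `γ : D ⟶ X` relative to `e : X ⟶ B`, that is, an action `ξ` on `γ` of the
kernel pair of `e`. It is encoded by the equivalence relation on `D` that it generates: `P` is the
pullback of `γ ≫ e` and `e`, with first projection `π`, and its second projection is `ξ ≫ γ`. -/
structure IsDescentDatum {X B D P : Y} (e : X ⟶ B) (γ : D ⟶ X) (π ξ : P ⟶ D) : Prop where
  isEquivalenceRelation : IsEquivalenceRelation π ξ
  isPullback : IsPullback π (ξ ≫ γ) (γ ≫ e) e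

/-- Every descent datum relative to `e` on an object satisfying `O` is effective: it is the
canonical one on the pullback along `e` of a morphism `a` whose domain satisfies `O`. -/
def HasEffectiveDescentData (O : ObjectProperty Y) {X B : Y} (e : X ⟶ B) : Prop :=
  ∀ ⦃D P : Y⦄ ⦃γ : D ⟶ X⦄ ⦃π ξ : P ⟶ D⦄, O D → IsDescentDatum e γ π ξ →
    ∃ (A : Y) (q : D ⟶ A) (a : A ⟶ B), O A ∧ IsPullback q γ a e ∧ π ≫ q = ξ ≫ q

theorem isKernelPair_of_isPullback {X B D P A : Y} {e : X ⟶ B} {γ : D ⟶ X} {π ξ : P ⟶ D}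
    {q : D ⟶ A} {a : A ⟶ B} (hq : IsPullback q γ a e)
    (hP : IsPullback π (ξ ≫ γ) (γ ≫ e) e) (h : π ≫ q = ξ ≫ q) : IsKernelPair q π ξ := by
  rw [← hq.w] at hP
  exact (IsPullback.of_right hP.flip h.symm hq.flip).flip

theorem isDescentDatum_of_refl_of_trans {X B D P Q : Y} {e : X ⟶ B} {γ : D ⟶ X}
    {π ξ : P ⟶ D} (hP : IsPullback π (ξ ≫ γ) (γ ≫ e) e) (r : D ⟶ P) (hr₁ : r ≫ π = 𝟙 D)
    (hr₂ : r ≫ ξ = 𝟙 D) {x y : Q ⟶ P} (hQ : IsPullback x y ξ π) (t : Q ⟶ P)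
    (ht₁ : t ≫ π = x ≫ π) (ht₂ : t ≫ ξ = y ≫ ξ) : IsDescentDatum e γ π ξ := by
  let s : P ⟶ P := hP.lift ξ (π ≫ γ) (by simpa using hP.w.symm)
  have hs₁ : s ≫ π = ξ := hP.lift_fst _ _ _
  have hsγ : s ≫ ξ ≫ γ = π ≫ γ := hP.lift_snd _ _ _
  -- In terms of elements, transitivity applied to `x ∼ y` and `y ∼ z`, where `z` lies over the
  -- same point of `X` as `x`, gives `x ∼ z`, hence `z = x`.
  let u : P ⟶ Q := hQ.lift (𝟙 P) s (by rw [Category.id_comp, hs₁])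
  have hux : u ≫ x = 𝟙 P := hQ.lift_fst _ _ _
  have huy : u ≫ y = s := hQ.lift_snd _ _ _
  have hut : u ≫ t = π ≫ r := hP.hom_ext
    (by rw [Category.assoc, ht₁, reassoc_of% hux, Category.assoc, hr₁, Category.comp_id])
    (by rw [Category.assoc, reassoc_of% ht₂, reassoc_of% huy, hsγ, Category.assoc,
      reassoc_of% hr₂])
  have hs₂ : s ≫ ξ = π := by
    rw [← huy, Category.assoc, ← ht₂, reassoc_of% hut, hr₂, Category.comp_id]
  refine ⟨⟨⟨{
    right_cancellation := fun _ _ _ h₁ h₂ => hP.hom_ext h₁ (by rw [reassoc_of% h₂])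
    r := r
    reflexivity₁ := hr₁
    reflexivity₂ := hr₂
    s := s
    symmetry₁ := hs₁
    symmetry₂ := hs₂
    c := hQ.cone
    isLimit := hQ.isLimit
    t := t
    transitivity₁ := ht₁
    transitivity₂ := ht₂ }⟩⟩, hP⟩

theorem IsDescentDatum.map {Z : Type*} [Category* Z] (F : Y ⥤ Z) {X B D P : Y} {e : X ⟶ B}
    {γ : D ⟶ X} {π ξ : P ⟶ D} (h : IsDescentDatum e γ π ξ)
    [PreservesLimit (cospan (γ ≫ e) e) F] [PreservesLimit (cospan ξ π) F] :
    IsDescentDatum (F.map e) (F.map γ) (F.map π) (F.map ξ) := by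
  obtain ⟨⟨⟨R⟩⟩, hP⟩ := h
  have hQ : IsPullback R.c.fst R.c.snd ξ π := ⟨⟨R.c.condition⟩, ⟨.ofIsoLimit R.isLimit R.c.eta⟩⟩
  refine isDescentDatum_of_refl_of_trans (by simpa only [F.map_comp] using hP.map F) (F.map R.r)
    ?_ ?_ (hQ.map F) (F.map R.t) ?_ ?_
  · rw [← F.map_comp, R.reflexivity₁, F.map_id]
  · rw [← F.map_comp, R.reflexivity₂, F.map_id]
  · rw [← F.map_comp, R.transitivity₁, F.map_comp]
  · rw [← F.map_comp, R.transitivity₂, F.map_comp]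

theorem isDescentDatum_of_action {X B D : Y} (e : X ⟶ B) [HasPullbacksAlong e] (γ : D ⟶ X)
    (ξ : pullback (γ ≫ e) e ⟶ D) (hξ : ξ ≫ γ = pullback.snd (γ ≫ e) e)
    (hunit : pullback.lift (𝟙 D) γ (Category.id_comp _) ≫ ξ = 𝟙 D)
    (hassoc : pullback.lift (pullback.fst (pullback.snd (γ ≫ e) e ≫ e) e ≫ pullback.fst _ _)
        (pullback.snd _ _) (by rw [Category.assoc, pullback.condition, pullback.condition]) ≫ ξ =
      pullback.lift (pullback.fst (pullback.snd (γ ≫ e) e ≫ e) e ≫ ξ) (pullback.snd _ _)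
        (by rw [Category.assoc, reassoc_of% hξ, pullback.condition]) ≫ ξ) :
    IsDescentDatum e γ (pullback.fst (γ ≫ e) e) ξ := by
  have hP : IsPullback (pullback.fst (γ ≫ e) e) (ξ ≫ γ) (γ ≫ e) e := by
    rw [hξ]
    exact IsPullback.of_hasPullback _ _
  refine isDescentDatum_of_refl_of_trans hP _ (pullback.lift_fst _ _ _) hunit ?_ _
    (pullback.lift_fst _ _ _) hassoc
  refine (IsPullback.of_right ?_ (pullback.lift_fst _ _ _) hP.flip).flip
  simpa only [hξ, reassoc_of% hξ, pullback.lift_snd] using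
    (IsPullback.of_hasPullback (pullback.snd (γ ≫ e) e ≫ e) e).flip

section Criterion

variable {X B : Y} {e : X ⟶ B} [HasPullbacksAlong e]

theorem exists_pullback_fst_comp_eq {A W : Y} (a : A ⟶ B) [IsRegularEpi (pullback.fst a e)]
    (k : pullback a e ⟶ W)
    (hk : pullback.lift (pullback.fst (pullback.snd a e ≫ e) e ≫ pullback.fst a e)
        (pullback.snd _ _) (by rw [Category.assoc, pullback.condition, pullback.condition]) ≫ k =
      pullback.fst _ _ ≫ k) :
    ∃ l : A ⟶ W, pullback.fst a e ≫ l = k := by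
  have hw : (pullback.fst (pullback.snd a e ≫ e) e ≫ pullback.fst a e) ≫ a =
      pullback.snd (pullback.snd a e ≫ e) e ≫ e := by
    rw [Category.assoc, pullback.condition, pullback.condition]
  have hker := isKernelPair_of_isPullback (π := pullback.fst (pullback.snd a e ≫ e) e)
    (ξ := pullback.lift _ _ hw) (IsPullback.of_hasPullback a e)
    (by rw [pullback.lift_snd]; exact IsPullback.of_hasPullback _ _)
    (pullback.lift_fst _ _ hw).symm
  exact IsRegularEpi.exists_of_isKernelPair _ hker k hk.symm

theorem isEffectiveDescent_of_isRegularEpi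
    [∀ {A : Y} (a : A ⟶ B), IsRegularEpi (pullback.fst a e)]
    (heff : HasEffectiveDescentData ⊤ e) : IsEffectiveDescent e := by
  refine ⟨inferInstance,
    nonempty_monadicRightAdjoint (Over.mapPullbackAdj e) ?_ fun {M} ξ hunit hassoc => ?_⟩
  · intro A W k hk
    obtain ⟨l, hl⟩ := exists_pullback_fst_comp_eq A.hom k.left (by simpa using congr(($hk).left))
    refine ⟨Over.homMk l ?_, ?_⟩
    · rw [← cancel_epi (pullback.fst A.hom e), reassoc_of% hl]
      simp [pullback.condition]
    · ext
      simpa using hl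
  · obtain ⟨A, q, a, -, hq, hξ⟩ := heff trivial <| isDescentDatum_of_action e M.hom ξ.left
      (Over.w ξ) (by simpa using congr(($hunit).left)) (by simpa using congr(($hassoc).left))
    refine ⟨Over.mk a, Over.isoMk hq.isoPullback hq.isoPullback_hom_snd, ?_⟩
    ext
    simpa using hξ.symm

theorem isEffectiveRelDescent_of_isRegularEpi {E : MorphismProperty Y}
    [E.IsStableUnderComposition] [E.IsStableUnderBaseChangeAlong e]
    [∀ {A : Y} (a : A ⟶ B), IsRegularEpi (pullback.fst a e)] (he : E e)
    (heff : HasEffectiveDescentData ⊤ e)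
    (hloc : ∀ {A D : Y} {q : D ⟶ A} {γ : D ⟶ X} {a : A ⟶ B}, IsPullback q γ a e → E γ → E a) :
    IsEffectiveRelDescent E e := by
  let adj := MorphismProperty.Over.mapPullbackAdj E ⊤ e he trivial
  have : (MorphismProperty.Over.pullback E ⊤ e).Faithful := ⟨fun {A _ f g} hfg => by
    ext
    rw [← cancel_epi (pullback.fst A.hom e)]
    have h := congr(($hfg).left ≫ pullback.fst _ e)
    exact (pullback.lift_fst _ _ _).symm.trans (h.trans (pullback.lift_fst _ _ _))⟩
  refine ⟨fun k hk => E.comp_mem k e hk he, inferInstance, inferInstance,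
    nonempty_monadicRightAdjoint adj ?_ fun {M} ξ hunit hassoc => ?_⟩
  · intro A W k hk
    obtain ⟨l, hl⟩ := exists_pullback_fst_comp_eq A.hom k.left congr(($hk).left)
    refine ⟨MorphismProperty.Over.homMk l ?_, ?_⟩
    · rw [← cancel_epi (pullback.fst A.hom e), reassoc_of% hl, pullback.condition]
      exact MorphismProperty.Over.w k
    · ext
      exact hl
  · obtain ⟨A, q, a, -, hq, hξ⟩ := heff trivial <| isDescentDatum_of_action e M.hom ξ.left
      (MorphismProperty.Over.w ξ) congr(($hunit).left) congr(($hassoc).left)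
    refine ⟨MorphismProperty.Over.mk ⊤ a (hloc hq M.prop),
      MorphismProperty.Over.isoMk hq.isoPullback hq.isoPullback_hom_snd, ?_⟩
    ext
    change ξ.left ≫ hq.isoPullback.hom ≫ pullback.fst a e =
      pullback.fst (M.hom ≫ e) e ≫ hq.isoPullback.hom ≫ pullback.fst a e
    rw [hq.isoPullback_hom_fst]
    exact hξ.symm

end Criterion

end DescentData

section ExtensionClass

variable {Y : Type u} [Category.{v} Y]

/-- `E` is a class of extensions between the objects satisfying `O`: a class of regular
epimorphisms between such objects, closed under composition, right cancellation and pullback, and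
relative to which descent data on objects satisfying `O` are effective. The classes `ℰₙ₊₁` are of
this kind, with `O` selecting the `n`-fold extensions, and this notion is inherited by double
extensions. -/
structure IsExtensionClass (O : ObjectProperty Y) (E : MorphismProperty Y) : Prop extends
    E.IsStableUnderComposition, E.HasOfPrecompProperty E where
  dom {X Z : Y} {f : X ⟶ Z} : E f → O X
  cod {X Z : Y} {f : X ⟶ Z} : E f → O Z
  isRegularEpi {X Z : Y} {f : X ⟶ Z} : E f → IsRegularEpi f
  hasPullback {X Z W : Y} (f : X ⟶ W) {g : Z ⟶ W} : E g → O X → HasPullback f g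
  baseChange {P X Z W : Y} {p : P ⟶ X} {q : P ⟶ Z} {f : X ⟶ W} {g : Z ⟶ W} :
    IsPullback p q f g → E g → O X → E p
  descent {X B : Y} {e : X ⟶ B} : E e → HasEffectiveDescentData O e

namespace IsExtensionClass

section Descent

variable {E : MorphismProperty Y} {X B : Y} {e : X ⟶ B}

theorem isEffectiveDescent (h : IsExtensionClass ⊤ E) (he : E e) : IsEffectiveDescent e := by
  have : HasPullbacksAlong e := fun a => h.hasPullback a he trivial
  have {A : Y} (a : A ⟶ B) : IsRegularEpi (pullback.fst a e) :=
    h.isRegularEpi (h.baseChange (IsPullback.of_hasPullback a e) he trivial)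
  exact isEffectiveDescent_of_isRegularEpi (h.descent he)

theorem isEffectiveRelDescent (h : IsExtensionClass ⊤ E) (he : E e) :
    IsEffectiveRelDescent E e := by
  have := h.toIsStableUnderComposition
  have : HasPullbacksAlong e := fun a => h.hasPullback a he trivial
  have hfst {P A : Y} {q : P ⟶ A} {γ : P ⟶ X} {a : A ⟶ B} (hq : IsPullback q γ a e) : E q :=
    h.baseChange hq he trivial
  have {A : Y} (a : A ⟶ B) : IsRegularEpi (pullback.fst a e) :=
    h.isRegularEpi (hfst (IsPullback.of_hasPullback a e))
  have : E.IsStableUnderBaseChangeAlong e :=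
    ⟨fun hq ha => h.baseChange hq.flip ha trivial⟩
  refine isEffectiveRelDescent_of_isRegularEpi he (h.descent he) fun hq hγ =>
    h.of_precomp _ _ (hfst hq) ?_
  rw [hq.w]
  exact h.comp_mem _ _ hγ he

end Descent

end IsExtensionClass

theorem isRegularEpi_of_map {Z : Type*} [Category* Z] (F : Y ⥤ Z) [F.Full] [F.Faithful] {A B : Y}
    (f : A ⟶ B) [HasPullback f f] [PreservesLimit (cospan f f) F] [IsRegularEpi (F.map f)] :
    IsRegularEpi f := by
  have : Epi f := F.epi_of_epi_map inferInstance
  refine IsRegularEpi.of_epi_of_exists fun W g hg => ?_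
  obtain ⟨k, hk⟩ := IsRegularEpi.exists_of_isKernelPair (F.map f)
    ((IsPullback.of_hasPullback f f).map F) (F.map g) (by rw [← F.map_comp, hg, F.map_comp])
  exact ⟨F.preimage k, F.map_injective (by rw [F.map_comp, F.map_preimage, hk])⟩

section FullSubcategory

variable {O : ObjectProperty Y}

theorem hasPullback_and_preservesLimit_ι {X Z W : O.FullSubcategory} (f : X ⟶ W) (g : Z ⟶ W)
    [HasPullback f.hom g.hom] (hO : O (pullback f.hom g.hom)) :
    HasPullback f g ∧ PreservesLimit (cospan f g) O.ι := by
  let P : O.FullSubcategory := ⟨pullback f.hom g.hom, hO⟩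
  let p : P ⟶ X := O.homMk (pullback.fst f.hom g.hom)
  let q : P ⟶ Z := O.homMk (pullback.snd f.hom g.hom)
  have hι : IsPullback (O.ι.map p) (O.ι.map q) (O.ι.map f) (O.ι.map g) :=
    IsPullback.of_hasPullback f.hom g.hom
  have h : IsPullback p q f g := IsPullback.of_map_of_faithful O.ι hι
  exact ⟨h.hasPullback, preservesLimit_of_preserves_limit_cone h.isLimit
    ((isLimitMapConePullbackConeEquiv O.ι h.w).symm hι.isLimit)⟩

theorem IsExtensionClass.fullSubcategory {E : MorphismProperty Y} (h : IsExtensionClass O E) :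
    IsExtensionClass (⊤ : ObjectProperty O.FullSubcategory) (E.inverseImage O.ι) := by
  have hasPullback_and_preserves {X Z W : O.FullSubcategory} (f : X ⟶ W) {g : Z ⟶ W}
      (hg : E g.hom) : HasPullback f g ∧ PreservesLimit (cospan f g) O.ι := by
    have := h.hasPullback f.hom hg X.property
    exact hasPullback_and_preservesLimit_ι f g
      (h.dom (h.baseChange (IsPullback.of_hasPullback f.hom g.hom) hg X.property))
  have baseChange {P X Z W : O.FullSubcategory} {p : P ⟶ X} {q : P ⟶ Z} {f : X ⟶ W}
      {g : Z ⟶ W} (hp : IsPullback p q f g) (hg : E g.hom) : E p.hom := by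
    have := (hasPullback_and_preserves f hg).2
    exact h.baseChange (hp.map O.ι) hg X.property
  exact {
    comp_mem f g hf hg := h.comp_mem f.hom g.hom hf hg
    of_precomp f g hf hfg := h.of_precomp f.hom g.hom hf hfg
    dom _ := trivial
    cod _ := trivial
    isRegularEpi {X Z f} hf := by
      obtain ⟨_, _⟩ := hasPullback_and_preserves f (g := f) hf
      have : IsRegularEpi (O.ι.map f) := h.isRegularEpi hf
      exact isRegularEpi_of_map O.ι f
    hasPullback f g hg _ := (hasPullback_and_preserves f (g := g) hg).1
    baseChange hp hg _ := baseChange hp hg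
    descent {X B e} he D P γ π ξ _ hd := by
      have := (hasPullback_and_preserves (γ ≫ e) (g := e) he).2
      have := (hasPullback_and_preserves ξ (baseChange hd.isPullback he)).2
      obtain ⟨A, q, a, hA, hq, hξ⟩ := h.descent he D.property (hd.map O.ι)
      exact ⟨⟨A, hA⟩, ⟨q⟩, ⟨a⟩, trivial, IsPullback.of_map_of_faithful O.ι hq,
        O.ι.map_injective hξ⟩ }

end FullSubcategory

end ExtensionClass

section Regular

variable {C : Type u} [Category.{v} C]

theorem isPullback_of_isKernelPair [Regular C] {X B D P A : C} {e : X ⟶ B} {γ : D ⟶ X}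
    {π ξ : P ⟶ D} {q : D ⟶ A} {a : A ⟶ B} [IsRegularEpi q] (hq : IsKernelPair q π ξ)
    (h : IsPullback π (ξ ≫ γ) (γ ≫ e) e) (w : q ≫ a = γ ≫ e) : IsPullback q γ a e := by
  let m : D ⟶ pullback a e := pullback.lift q γ w
  have hm₁ : m ≫ pullback.fst a e = q := pullback.lift_fst _ _ _
  have hm₂ : m ≫ pullback.snd a e = γ := pullback.lift_snd _ _ _
  -- If `m` identifies `d` and `d'`, then the elements `(d, d')` and `(d, d)` of the kernel pair
  -- have the same images under `π` and `ξ ≫ γ`, hence are equal.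
  have : Mono m := ⟨fun {T} d d' hd => by
    have hdq : d ≫ q = d' ≫ q := by rw [← hm₁, reassoc_of% hd]
    have hdγ : d ≫ γ = d' ≫ γ := by rw [← hm₂, reassoc_of% hd]
    have hz : hq.lift d d' hdq = hq.lift d d rfl := h.hom_ext
      (by rw [hq.lift_fst, hq.lift_fst])
      (by rw [hq.lift_snd_assoc, hq.lift_snd_assoc, hdγ])
    rw [← hq.lift_snd d d rfl, ← hz, hq.lift_snd]⟩
  have hsq : IsPullback π (ξ ≫ m) q (pullback.fst a e) := by
    refine (IsPullback.of_right ?_ ?_ (IsPullback.of_hasPullback a e).flip).flip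
    · rw [Category.assoc, hm₂, w]
      exact h.flip
    · rw [Category.assoc, hm₁, hq.w]
  have : IsRegularEpi (ξ ≫ m) :=
    Regular.regularEpiIsStableUnderBaseChange.of_isPullback hsq (inferInstanceAs (IsRegularEpi q))
  have : StrongEpi m := strongEpi_of_strongEpi ξ m
  have : IsIso m := isIso_of_mono_of_strongEpi m
  exact IsPullback.of_iso_pullback ⟨w⟩ (asIso m) hm₁ hm₂

theorem BarrExact.hasEffectiveDescentData [BarrExact C] {X B : C} (e : X ⟶ B) :
    HasEffectiveDescentData ⊤ e := by
  intro D P γ π ξ _ hd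
  have := hd.isEquivalenceRelation
  obtain ⟨⟨ε⟩⟩ := BarrExact.effective π ξ
  have hq : π ≫ ε.π = ξ ≫ ε.π := ε.isPushout.w
  have hw : π ≫ γ ≫ e = ξ ≫ γ ≫ e := by rw [hd.isPullback.w, Category.assoc]
  exact ⟨ε.B, ε.π, ε.isPushout.desc _ _ hw, trivial,
    isPullback_of_isKernelPair ε.isKernelPair hd.isPullback (ε.isPushout.inl_desc _ _ hw), hq⟩

theorem isExtensionClass_regularEpi [BarrExact C] :
    IsExtensionClass ⊤ (MorphismProperty.regularEpi C) where
  comp_mem f g hf hg := by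
    rw [MorphismProperty.regularEpi_iff] at *
    infer_instance
  of_precomp f g _ hfg := by
    rw [MorphismProperty.regularEpi_iff] at *
    have : StrongEpi g := strongEpi_of_strongEpi f g
    infer_instance
  dom _ := trivial
  cod _ := trivial
  isRegularEpi hf := hf
  hasPullback _ _ _ _ := inferInstance
  baseChange hp hg _ := Regular.regularEpiIsStableUnderBaseChange.of_isPullback hp.flip hg
  descent _ := BarrExact.hasEffectiveDescentData _

end Regular

section ArrowCategory

variable {Y : Type u} [Category.{v} Y]

section Limits

variable {J : Type*} [Category* J] [HasLimitsOfShape J Y]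

instance preservesLimitsOfShape_leftFunc :
    PreservesLimitsOfShape J (Arrow.leftFunc : Arrow Y ⥤ Y) where
  preservesLimit := preservesLimit_of_preserves_limit_cone
    (Comma.coneOfPreservesIsLimit _ (limit.isLimit _) (limit.isLimit _)) (limit.isLimit _)

instance preservesLimitsOfShape_rightFunc :
    PreservesLimitsOfShape J (Arrow.rightFunc : Arrow Y ⥤ Y) where
  preservesLimit := preservesLimit_of_preserves_limit_cone
    (Comma.coneOfPreservesIsLimit _ (limit.isLimit _) (limit.isLimit _)) (limit.isLimit _)

end Limits

theorem isPullback_arrow {P X Z W : Arrow Y} {p : P ⟶ X} {q : P ⟶ Z} {f : X ⟶ W} {g : Z ⟶ W}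
    (hl : IsPullback p.left q.left f.left g.left)
    (hr : IsPullback p.right q.right f.right g.right) : IsPullback p q f g := by
  have w : p ≫ f = q ≫ g := by
    ext
    · exact hl.w
    · exact hr.w
  exact ⟨⟨w⟩, ⟨Comma.fstSndJointlyReflectLimit
    ((isLimitMapConePullbackConeEquiv _ w).symm hl.isLimit)
    ((isLimitMapConePullbackConeEquiv _ w).symm hr.isLimit)⟩⟩

theorem isRegularEpi_arrow [HasPullbacks Y] {X Z : Arrow Y} (f : X ⟶ Z) [IsRegularEpi f.left]
    [IsRegularEpi f.right] : IsRegularEpi f := by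
  have hl : IsKernelPair f.left _ _ := (IsPullback.of_hasPullback f f).map Arrow.leftFunc
  have hr : IsKernelPair f.right _ _ := (IsPullback.of_hasPullback f f).map Arrow.rightFunc
  have hf : IsColimit (Cofork.ofπ f pullback.condition) := Comma.fstSndJointlyReflectColimit
    ((isColimitMapCoconeCoforkEquiv _ _).symm hl.toCoequalizer')
    ((isColimitMapCoconeCoforkEquiv _ _).symm hr.toCoequalizer')
  exact isRegularEpi_of_regularEpi (Cofork.IsColimit.regularEpi hf)

theorem exists_isPullback_arrow_mk {X B D P : Arrow Y} {e : X ⟶ B} {γ : D ⟶ X} {π ξ : P ⟶ D}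
    {A A' : Y} {q : D.left ⟶ A} {a : A ⟶ B.left} {q' : D.right ⟶ A'} {a' : A' ⟶ B.right}
    [IsRegularEpi q] (hq : IsPullback q γ.left a e.left)
    (hq' : IsPullback q' γ.right a' e.right) (hker : IsKernelPair q π.left ξ.left)
    (hξ : π.right ≫ q' = ξ.right ≫ q') :
    ∃ (m : A ⟶ A') (p : D ⟶ Arrow.mk m) (b : Arrow.mk m ⟶ B),
      IsPullback p γ b e ∧ π ≫ p = ξ ≫ p := by
  obtain ⟨m, hm⟩ := IsRegularEpi.exists_of_isKernelPair q hker (D.hom ≫ q') (by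
    rw [Arrow.w_assoc, Arrow.w_assoc, hξ])
  have hb : a ≫ B.hom = m ≫ a' := by
    rw [← cancel_epi q, hq.w_assoc, reassoc_of% hm, hq'.w, Arrow.w, Arrow.w_assoc]
  refine ⟨m, Arrow.homMk q q' hm, Arrow.homMk a a' hb, isPullback_arrow hq hq', ?_⟩
  ext
  · exact hker.w
  · exact hξ

section Comparison

variable [HasPullbacks Y]

/-- The comparison map of a square, from its top left corner to the pullback of its bottom and
right sides. -/
noncomputable def comparison {f g : Arrow Y} (α : f ⟶ g) : f.left ⟶ pullback α.right g.hom :=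
  pullback.lift f.hom α.left (Arrow.w α).symm

theorem comparison_fst {f g : Arrow Y} (α : f ⟶ g) : comparison α ≫ pullback.fst _ _ = f.hom :=
  pullback.lift_fst _ _ _

theorem comparison_snd {f g : Arrow Y} (α : f ⟶ g) : comparison α ≫ pullback.snd _ _ = α.left :=
  pullback.lift_snd _ _ _

theorem exists_isPullback_comparison_comp {f g k : Arrow Y} (α : f ⟶ g) (β : g ⟶ k) :
    ∃ (c : pullback α.right g.hom ⟶ pullback (α ≫ β).right k.hom)
      (t : pullback (α ≫ β).right k.hom ⟶ pullback β.right k.hom),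
      comparison α ≫ c = comparison (α ≫ β) ∧
        comparison (α ≫ β) ≫ t = α.left ≫ comparison β ∧
          IsPullback c (pullback.snd _ _) t (comparison β) ∧
            IsPullback t (pullback.fst _ _) (pullback.fst _ _) α.right := by
  let c : pullback α.right g.hom ⟶ pullback (α ≫ β).right k.hom :=
    pullback.lift (pullback.fst _ _) (pullback.snd _ _ ≫ β.left) (by
      rw [Arrow.comp_right, pullback.condition_assoc, Category.assoc, Arrow.w])
  let t : pullback (α ≫ β).right k.hom ⟶ pullback β.right k.hom :=
    pullback.lift (pullback.fst _ _ ≫ α.right) (pullback.snd _ _) (by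
      rw [Category.assoc, ← Arrow.comp_right, pullback.condition])
  have hc₁ : c ≫ pullback.fst _ _ = pullback.fst _ _ := pullback.lift_fst _ _ _
  have hc₂ : c ≫ pullback.snd _ _ = pullback.snd _ _ ≫ β.left := pullback.lift_snd _ _ _
  have ht₁ : t ≫ pullback.fst _ _ = pullback.fst _ _ ≫ α.right := pullback.lift_fst _ _ _
  have ht₂ : t ≫ pullback.snd _ _ = pullback.snd _ _ := pullback.lift_snd _ _ _
  have ht : IsPullback t (pullback.fst _ _) (pullback.fst _ _) α.right := by
    refine IsPullback.of_right ?_ ht₁ (IsPullback.of_hasPullback β.right k.hom).flip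
    rw [ht₂]
    exact (IsPullback.of_hasPullback (α ≫ β).right k.hom).flip
  have hct : c ≫ t = pullback.snd _ _ ≫ comparison β := by
    apply pullback.hom_ext
    · rw [Category.assoc, ht₁, reassoc_of% hc₁, pullback.condition, Category.assoc,
        comparison_fst]
    · rw [Category.assoc, ht₂, hc₂, Category.assoc, comparison_snd]
  have hc : IsPullback c (pullback.snd _ _) t (comparison β) := by
    refine IsPullback.of_right ?_ hct ht.flip
    rw [hc₁, comparison_fst]
    exact IsPullback.of_hasPullback α.right g.hom
  refine ⟨c, t, ?_, ?_, hc, ht⟩ <;> apply pullback.hom_ext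
  · rw [Category.assoc, hc₁, comparison_fst, comparison_fst]
  · rw [Category.assoc, hc₂, reassoc_of% comparison_snd, comparison_snd, Arrow.comp_left]
  · rw [Category.assoc, ht₁, reassoc_of% comparison_fst, Category.assoc, comparison_fst, Arrow.w]
  · rw [Category.assoc, ht₂, comparison_snd, Category.assoc, comparison_snd, Arrow.comp_left]

theorem exists_isPullback_comparison {P X Z W : Arrow Y} {p : P ⟶ X} {q : P ⟶ Z} {f : X ⟶ W}
    {g : Z ⟶ W} (h : IsPullback p q f g) :
    ∃ t : pullback p.right X.hom ⟶ pullback g.right W.hom,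
      IsPullback (comparison p) q.left t (comparison g) := by
  have hl : IsPullback p.left q.left f.left g.left := h.map Arrow.leftFunc
  have hr : IsPullback p.right q.right f.right g.right := h.map Arrow.rightFunc
  let t : pullback p.right X.hom ⟶ pullback g.right W.hom :=
    pullback.map _ _ _ _ q.right f.left f.right hr.w (Arrow.w f).symm
  have ht₁ : t ≫ pullback.fst _ _ = pullback.fst _ _ ≫ q.right := pullback.lift_fst _ _ _
  have ht₂ : t ≫ pullback.snd _ _ = pullback.snd _ _ ≫ f.left := pullback.lift_snd _ _ _
  have ht : IsPullback (pullback.snd _ _) t f.left (pullback.snd _ _) := by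
    refine (IsPullback.of_right ?_ ht₂ (IsPullback.of_hasPullback g.right W.hom)).flip
    rw [ht₁, Arrow.w]
    exact (IsPullback.of_hasPullback p.right X.hom).paste_horiz hr.flip
  refine ⟨t, (IsPullback.of_bot (v₂₁ := pullback.snd _ _) ?_ ?_ ht.flip).flip⟩
  · rw [comparison_snd, comparison_snd]
    exact hl.flip
  · apply pullback.hom_ext
    · rw [Category.assoc, comparison_fst, Category.assoc, ht₁, reassoc_of% comparison_fst, Arrow.w]
    · rw [Category.assoc, comparison_snd, Category.assoc, ht₂, reassoc_of% comparison_snd, hl.w]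

end Comparison

end ArrowCategory

namespace IsExtensionClass

section DoubleExtension

variable {Y : Type u} [Category.{v} Y] [HasPullbacks Y] {O : ObjectProperty Y}
  {E : MorphismProperty Y}

theorem doubleExtension_iff (h : IsExtensionClass O E) {f g : Arrow Y} {α : f ⟶ g} :
    doubleExtension E α ↔
      E f.hom ∧ E g.hom ∧ E α.left ∧ E α.right ∧ E (comparison α) := by
  have hpb := IsPullback.of_hasPullback α.right g.hom
  constructor
  · rintro ⟨hf, hg, hl, hr, P, π₁, π₂, p, hP, hp₁, hp₂, -, -, hp⟩
    refine ⟨hf, hg, hl, hr, ?_⟩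
    let i := hpb.isoIsPullback _ _ hP
    have hi₁ : i.hom ≫ π₁ = pullback.fst _ _ := hpb.isoIsPullback_hom_fst _ _ hP
    have hi₂ : i.hom ≫ π₂ = pullback.snd _ _ := hpb.isoIsPullback_hom_snd _ _ hP
    have hpi : comparison α ≫ i.hom = 𝟙 _ ≫ p := hP.hom_ext
      (by rw [Category.assoc, hi₁, comparison_fst, Category.id_comp, hp₁])
      (by rw [Category.assoc, hi₂, comparison_snd, Category.id_comp, hp₂])
    exact h.baseChange (IsPullback.of_vert_isIso ⟨hpi⟩) hp
      (h.dom (h.baseChange hpb hg (h.cod hf)))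
  · rintro ⟨hf, hg, hl, hr, hα⟩
    exact ⟨hf, hg, hl, hr, _, _, _, comparison α, hpb, comparison_fst α, comparison_snd α,
      h.baseChange hpb hg (h.cod hf), h.baseChange hpb.flip hr (h.dom hg), hα⟩

theorem doubleExtension_comp (h : IsExtensionClass O E) {f g k : Arrow Y} {α : f ⟶ g}
    {β : g ⟶ k} (hα : doubleExtension E α) (hβ : doubleExtension E β) :
    doubleExtension E (α ≫ β) := by
  rw [h.doubleExtension_iff] at *
  obtain ⟨hf, -, hαl, hαr, hα⟩ := hα
  obtain ⟨-, hk, hβl, hβr, hβ⟩ := hβ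
  have hr : E (α ≫ β).right := h.comp_mem _ _ hαr hβr
  obtain ⟨c, _, hc, -, hpb, -⟩ := exists_isPullback_comparison_comp α β
  have hcE : E c := h.baseChange hpb hβ
    (h.dom (h.baseChange (IsPullback.of_hasPullback (α ≫ β).right k.hom) hk (h.dom hr)))
  exact ⟨hf, hk, h.comp_mem _ _ hαl hβl, hr, hc ▸ h.comp_mem _ _ hα hcE⟩

theorem doubleExtension_of_comp (h : IsExtensionClass O E) {f g k : Arrow Y} {α : f ⟶ g}
    {β : g ⟶ k} (hα : doubleExtension E α) (hαβ : doubleExtension E (α ≫ β)) :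
    doubleExtension E β := by
  rw [h.doubleExtension_iff] at *
  obtain ⟨-, hg, hαl, hαr, -⟩ := hα
  obtain ⟨-, hk, hl, hr, hαβ⟩ := hαβ
  have hβr : E β.right := h.of_precomp _ _ hαr hr
  obtain ⟨-, t, -, ht, -, hpb⟩ := exists_isPullback_comparison_comp α β
  have htE : E t := h.baseChange hpb hαr
    (h.dom (h.baseChange (IsPullback.of_hasPullback β.right k.hom) hk (h.dom hβr)))
  exact ⟨hg, hk, h.of_precomp _ _ hαl hl, hβr,
    h.of_precomp _ _ hαl (ht ▸ h.comp_mem _ _ hαβ htE)⟩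

theorem doubleExtension_baseChange (h : IsExtensionClass O E) {P X Z W : Arrow Y} {p : P ⟶ X}
    {q : P ⟶ Z} {f : X ⟶ W} {g : Z ⟶ W} (hp : IsPullback p q f g) (hg : doubleExtension E g)
    (hX : E X.hom) : doubleExtension E p := by
  rw [h.doubleExtension_iff] at *
  obtain ⟨-, -, hgl, hgr, hg⟩ := hg
  have hpr : E p.right := h.baseChange (hp.map Arrow.rightFunc) hgr (h.cod hX)
  have hfst : E (pullback.fst p.right X.hom) :=
    h.baseChange (IsPullback.of_hasPullback _ _) hX (h.dom hpr)
  obtain ⟨t, ht⟩ := exists_isPullback_comparison hp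
  have hpE : E (comparison p) := h.baseChange ht hg (h.dom hfst)
  exact ⟨comparison_fst p ▸ h.comp_mem _ _ hpE hfst, hX,
    h.baseChange (hp.map Arrow.leftFunc) hgl (h.dom hX), hpr, hpE⟩

theorem hasEffectiveDescentData_arrow (h : IsExtensionClass O E) {X B : Arrow Y} {e : X ⟶ B}
    (hl : E e.left) (hr : E e.right) :
    HasEffectiveDescentData (fun f : Arrow Y => E f.hom) e := by
  intro D P γ π ξ hD hd
  have hdl := hd.map Arrow.leftFunc
  obtain ⟨A, q, a, hA, hq, hξ⟩ := h.descent hl (h.dom hD) hdl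
  obtain ⟨A', q', a', hA', hq', hξ'⟩ := h.descent hr (h.cod hD) (hd.map Arrow.rightFunc)
  have := h.isRegularEpi (h.baseChange hq hl hA)
  obtain ⟨m, p, b, hp, hξp⟩ := exists_isPullback_arrow_mk hq hq'
    (isKernelPair_of_isPullback hq hdl.isPullback hξ) hξ'
  have hpl : E p.left := h.baseChange (hp.map Arrow.leftFunc) hl hA
  have hpr : E p.right := h.baseChange (hp.map Arrow.rightFunc) hr hA'
  have hm : E m := h.of_precomp p.left m hpl (Arrow.w p ▸ h.comp_mem _ _ hD hpr)
  exact ⟨Arrow.mk m, p, b, hm, hp, hξp⟩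

theorem arrow (h : IsExtensionClass O E) :
    IsExtensionClass (fun f : Arrow Y => E f.hom) (doubleExtension E) where
  comp_mem _ _ := h.doubleExtension_comp
  of_precomp _ _ := h.doubleExtension_of_comp
  dom hf := hf.1
  cod hf := hf.2.1
  isRegularEpi {_ _ f} hf := by
    have := h.isRegularEpi hf.2.2.1
    have := h.isRegularEpi hf.2.2.2.1
    exact isRegularEpi_arrow f
  hasPullback _ _ _ _ := inferInstance
  baseChange := h.doubleExtension_baseChange
  descent he := h.hasEffectiveDescentData_arrow he.2.2.1 he.2.2.2.1

end DoubleExtension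

end IsExtensionClass

section Tower

variable (C : Type (max u v)) [Category.{v} C] [BarrExact C]

theorem hasPullbacks_hArr : ∀ n : ℕ, HasPullbacks (HArr.{v, u} C n)
  | 0 => inferInstanceAs (HasPullbacks C)
  | n + 1 => by
    have := hasPullbacks_hArr n
    exact inferInstanceAs (HasPullbacks (Arrow (HArr.{v, u} C n)))

theorem isExtensionClass_extClass :
    ∀ n : ℕ, IsExtensionClass (isExt.{v, u} C n) (extClass.{v, u} C n)
  | 0 => isExtensionClass_regularEpi (C := C)
  | n + 1 => by
    have := hasPullbacks_hArr.{v, u} C n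
    exact (isExtensionClass_extClass n).arrow

end Tower

end HigherExt

theorem mainTheorem7 (C : Type (max u v)) [Category.{v} C] [HigherExt.BarrExact C] (n : ℕ)
    {X B : HigherExt.ExtCat.{v, u} C n} (e : X ⟶ B) (he : HigherExt.ext.{v, u} C n e) :
    HigherExt.IsEffectiveDescent e ∧
      HigherExt.IsEffectiveRelDescent (HigherExt.ext.{v, u} C n) e := by
  have h := (HigherExt.isExtensionClass_extClass.{v, u} C n).fullSubcategory
  exact ⟨h.isEffectiveDescent he, h.isEffectiveRelDescent he⟩
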